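/- Let $1\le b\le n$, let $r:\mathbb R^n\to\mathbb R^m$ be continuously differentiable, let $f(x)=\frac12\sum_{i=1}^m r_i(x)^2$, and suppose that the Jacobian $J$ of $r$ is Lipschitz continuous on $\mathbb R^n$. Let $\kappa_i>0$ be a Lipschitz constant of $\nabla r_i$ ($i=1,\dots,m$), and put $\kappa_{\max}=\max_i\kappa_i$. All vector norms are Euclidean. Consider the following derivative-free Levenberg–Marquardt algorithm, with input $x_0\in\mathbb R^n$ such that $r_0:=r(x_0)\neq0$, constants $a_1>1>a_2>0$ with $a_1a_2<1$, $0<p_0<1$, $p_0<p_1<p_2$, $\theta_0\ge\theta_{\min}>0$, $\epsilon_0\ge0$, and a vector $d_{-1}\ne0$ (which only serves to fix the first smoothing parameter). In iteration $k=0,1,2,\dots$, independently of the past, a matrix $[u_1,\dots,u_b]$ is drawn from the uniform distribution on the Stiefel manifold $\{U\in\mathbb R^{n\times b}:U^TU=I_b\}$. With $\gamma_k=\|d_{k-1}\|$, let $J_{m_k}$ be the $m\times n$ matrix whose $i$-th row is the transpose of $$\frac nb\sum_{j=1}^b\frac{r_i(x_k+\gamma_ku_j)-r_i(x_k)}{\gamma_k}\,u_j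 ,$$ and let $\nabla f_{m_k}(x_k)=J_{m_k}^Tr(x_k)$. If $\|\nabla f_{m_k}(x_k)\|\le\epsilon_0$, stop. Otherwise let $d_k$ solve $(J_{m_k}^TJ_{m_k}+\theta_k\|\nabla f_{m_k}(x_k)\|I)d=-\nabla f_{m_k}(x_k)$ and let $$\rho_k=\frac{\|r(x_k)\|^2-\|r(x_k+d_k)\|^2}{\|r(x_k)\|^2-\|r(x_k)+J_{m_k}d_k\|^2}.$$ Put $x_{k+1}=x_k+d_k$ if $\rho_k\ge p_0$, and $x_{k+1}=x_k$ otherwise. Put $\theta_{k+1}=a_1\theta_k$ if $\rho_k<p_0$ or $\|\nabla f_{m_k}(x_k)\|<p_1/\theta_k$; otherwise put $\theta_{k+1}=\theta_k$ if $\|\nabla f_{m_k}(x_k)\|<p_2/\theta_k$, and $\theta_{k+1}=\max\{a_2\theta_k,\theta_{\min}\}$ if not. Denote by $X_k$, $D_k$, $\nabla f_{M_k}(X_k)$ the random variables whose realizations are $x_k$, $d_k$, $\nabla f_{m_k}(x_k)$ (with $D_{-1}=d_{-1}$), and by $\mathcal F_{k-1}$ the $\sigma$-algebra generated by the matrices drawn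 in the iterations before the $k$-th one. Let $\eta,\alpha\in(0,1)$ and suppose that $$b\ \ge\ \max\left\{\,n\Big/\left(\frac{\eta^2(1-p_0)^2(1-\alpha)}{(2+\eta(1-p_0))^2}+1\right),\ \frac n2\right\}.$$ Then the gradient models $\{\nabla f_{M_k}(X_k)\}$ are $\alpha$-probabilistically $(\xi_1,\xi_2)$-first-order accurate, that is, for every $k\ge0$, almost surely on the event that iteration $k$ is reached, $$\mathbb P\Big(\|\nabla f_{M_k}(X_k)-\nabla f(X_k)\|\le\xi_1\|\nabla f(X_k)\|+\xi_2\|D_{k-1}\|\ \Big|\ \mathcal F_{k-1}\Big)\ \ge\ \alpha ,$$ with $$\xi_1=\left(\frac{n/b-1}{1-\alpha}\right)^{1/2}\le\frac{\eta(1-p_0)}{2+\eta(1-p_0)},\qquad \xi_2=\sqrt m\,\kappa_{\max}\left(\frac n{2(1-\alpha)^{1/2}}+1\right)\|r_0\| .$$ -/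

import Mathlib

open MeasureTheory ProbabilityTheory

/-! ### The uniform distribution on the Stiefel manifold -/

/-- The orthogonal group is compact: it is closed and has entries bounded by one. -/
instance orthogonalGroupCompactSpace (n : ℕ) :
    CompactSpace (Matrix.orthogonalGroup (Fin n) ℝ) := by
  refine isCompact_iff_compactSpace.mp ?_
  have hbox : IsCompact (Set.pi Set.univ
      (fun _ : Fin n => Set.pi Set.univ (fun _ : Fin n => Set.Icc (-1 : ℝ) 1))) :=
    isCompact_univ_pi fun _ => isCompact_univ_pi fun _ => isCompact_Icc
  have hclosed : IsClosed {Q : Matrix (Fin n) (Fin n) ℝ |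
      Q ∈ Matrix.orthogonalGroup (Fin n) ℝ} := by
    have h : {Q : Matrix (Fin n) (Fin n) ℝ | Q ∈ Matrix.orthogonalGroup (Fin n) ℝ}
        = {Q | Q * star Q = 1} := by
      ext Q
      exact Matrix.mem_orthogonalGroup_iff (Fin n) ℝ
    rw [h]
    exact isClosed_eq (by fun_prop) continuous_const
  refine hbox.of_isClosed_subset hclosed ?_
  intro Q hQ i _ j _
  have h := entry_norm_bound_of_unitary (𝕜 := ℝ) hQ i j
  rw [Real.norm_eq_abs] at h
  exact abs_le.mp h

/-- The orthogonal group carries its Borel σ-algebra. -/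
instance orthogonalGroupMeasurableSpace (n : ℕ) :
    MeasurableSpace (Matrix.orthogonalGroup (Fin n) ℝ) := borel _

instance orthogonalGroupBorelSpace (n : ℕ) :
    BorelSpace (Matrix.orthogonalGroup (Fin n) ℝ) := ⟨rfl⟩

/-- The first `b` columns of an orthogonal matrix, an orthonormal `b`-frame of `ℝⁿ`. -/
noncomputable def firstColumns {n b : ℕ} (hbn : b ≤ n)
    (Q : Matrix.orthogonalGroup (Fin n) ℝ) : Fin b → EuclideanSpace ℝ (Fin n) :=
  fun j => WithLp.toLp 2 (fun i => (Q : Matrix (Fin n) (Fin n) ℝ) i (Fin.castLE hbn j))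

/-- The uniform distribution on the Stiefel manifold
`St(n, b) = {U ∈ ℝ^(n × b) : Uᵀ U = I}`, a matrix being given by the family of its columns: the law
of the first `b` columns of an orthogonal matrix distributed according to the Haar probability
measure of `O(n)`. It is the unique `O(n)`-invariant probability measure on `St(n, b)`. -/
noncomputable def stiefelUniform (n b : ℕ) (hbn : b ≤ n) :
    Measure (Fin b → EuclideanSpace ℝ (Fin n)) :=
  (Measure.haarMeasure (⊤ : TopologicalSpace.PositiveCompacts
    (Matrix.orthogonalGroup (Fin n) ℝ))).map (firstColumns hbn)

/-! ### The objective and its models -/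

/-- The least squares objective `f(x) = ½ ∑ᵢ rᵢ(x)²`. -/
noncomputable def lsObjective {n m : ℕ}
    (r : EuclideanSpace ℝ (Fin n) → EuclideanSpace ℝ (Fin m))
    (x : EuclideanSpace ℝ (Fin n)) : ℝ :=
  (1 / 2) * ∑ i, (r x i) ^ 2

/-- The approximation `(n/b) ∑ⱼ ((rᵢ(x + γ uⱼ) - rᵢ(x)) / γ) uⱼ` of `∇ rᵢ(x)` by orthogonal
spherical smoothing. -/
noncomputable def smoothedGrad {n m b : ℕ}
    (r : EuclideanSpace ℝ (Fin n) → EuclideanSpace ℝ (Fin m)) (γ : ℝ)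
    (u : Fin b → EuclideanSpace ℝ (Fin n)) (x : EuclideanSpace ℝ (Fin n)) (i : Fin m) :
    EuclideanSpace ℝ (Fin n) :=
  ((n : ℝ) / (b : ℝ)) • ∑ j, ((r (x + γ • u j) i - r x i) / γ) • u j

/-- The approximate Jacobian, whose `i`-th row is the approximation of `∇ rᵢ(x)`. -/
noncomputable def smoothedJacobian {n m b : ℕ}
    (r : EuclideanSpace ℝ (Fin n) → EuclideanSpace ℝ (Fin m)) (γ : ℝ)
    (u : Fin b → EuclideanSpace ℝ (Fin n)) (x : EuclideanSpace ℝ (Fin n)) :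
    Matrix (Fin m) (Fin n) ℝ :=
  Matrix.of fun i l => smoothedGrad r γ u x i l

/-- The gradient model `Jᵀ r(x)` given by an approximate Jacobian `J`. -/
noncomputable def modelGradient {n m : ℕ}
    (r : EuclideanSpace ℝ (Fin n) → EuclideanSpace ℝ (Fin m)) (J : Matrix (Fin m) (Fin n) ℝ)
    (x : EuclideanSpace ℝ (Fin n)) : EuclideanSpace ℝ (Fin n) :=
  WithLp.toLp 2 (J.transpose.mulVec (r x).ofLp)

/-! ### The derivative-free Levenberg-Marquardt algorithm -/

/-- The input constants of the algorithm; `θinit` is the starting value of the parameter `θ`. -/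
structure LMParams where
  a₁ : ℝ
  a₂ : ℝ
  p₀ : ℝ
  p₁ : ℝ
  p₂ : ℝ
  θmin : ℝ
  θinit : ℝ
  ε₀ : ℝ

/-- The requirements of the algorithm on its input constants. -/
def LMParams.Valid (c : LMParams) : Prop :=
  1 < c.a₁ ∧ c.a₂ < 1 ∧ 0 < c.a₂ ∧ c.a₁ * c.a₂ < 1 ∧ 0 < c.p₀ ∧ c.p₀ < 1 ∧ c.p₀ < c.p₁ ∧
    c.p₁ < c.p₂ ∧ 0 < c.θmin ∧ c.θmin ≤ c.θinit ∧ 0 ≤ c.ε₀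

/-- What the algorithm knows at the beginning of iteration `k`: the iterate `x_k`, the parameter
`θ_k`, and the step `d_{k-1}` computed in the preceding iteration (accepted or not). -/
structure LMState (n : ℕ) where
  x : EuclideanSpace ℝ (Fin n)
  θ : ℝ
  dPrev : EuclideanSpace ℝ (Fin n)

/-- The approximate Jacobian built in an iteration from the state `s` and the sampled frame `u`,
with smoothing parameter `γ_k = ‖d_{k-1}‖`. -/
noncomputable def LMState.jacobian {n m b : ℕ}
    (r : EuclideanSpace ℝ (Fin n) → EuclideanSpace ℝ (Fin m))
    (s : LMState n) (u : Fin b → EuclideanSpace ℝ (Fin n)) : Matrix (Fin m) (Fin n) ℝ :=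
  smoothedJacobian r ‖s.dPrev‖ u s.x

/-- The gradient model built in an iteration from the state `s` and the sampled frame `u`. -/
noncomputable def LMState.gradModel {n m b : ℕ}
    (r : EuclideanSpace ℝ (Fin n) → EuclideanSpace ℝ (Fin m))
    (s : LMState n) (u : Fin b → EuclideanSpace ℝ (Fin n)) : EuclideanSpace ℝ (Fin n) :=
  modelGradient r (s.jacobian r u) s.x

/-- The step `d_k`, the solution of `(Jᵀ J + λ I) d = - Jᵀ r(x_k)` with
`λ = θ_k ‖Jᵀ r(x_k)‖`. The matrix is positive definite whenever `θ_k > 0` and `Jᵀ r(x_k) ≠ 0`,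
which is the case whenever the algorithm does not stop. -/
noncomputable def LMState.direction {n m b : ℕ}
    (r : EuclideanSpace ℝ (Fin n) → EuclideanSpace ℝ (Fin m))
    (s : LMState n) (u : Fin b → EuclideanSpace ℝ (Fin n)) : EuclideanSpace ℝ (Fin n) :=
  WithLp.toLp 2 (-(((s.jacobian r u).transpose * s.jacobian r u
    + (s.θ * ‖s.gradModel r u‖) • (1 : Matrix (Fin n) (Fin n) ℝ))⁻¹.mulVec
      (s.gradModel r u).ofLp))

/-- The ratio `ρ_k` of the actual to the predicted reduction. -/
noncomputable def LMState.ratio {n m b : ℕ}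
    (r : EuclideanSpace ℝ (Fin n) → EuclideanSpace ℝ (Fin m))
    (s : LMState n) (u : Fin b → EuclideanSpace ℝ (Fin n)) : ℝ :=
  (‖r s.x‖ ^ 2 - ‖r (s.x + s.direction r u)‖ ^ 2) /
    (‖r s.x‖ ^ 2
      - ‖r s.x + WithLp.toLp 2 ((s.jacobian r u).mulVec (s.direction r u).ofLp)‖ ^ 2)

/-- The new value `θ_{k+1}` of the parameter. -/
noncomputable def LMState.nextθ {n m b : ℕ} (c : LMParams)
    (r : EuclideanSpace ℝ (Fin n) → EuclideanSpace ℝ (Fin m))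
    (s : LMState n) (u : Fin b → EuclideanSpace ℝ (Fin n)) : ℝ :=
  if s.ratio r u < c.p₀ then c.a₁ * s.θ
  else if ‖s.gradModel r u‖ < c.p₁ / s.θ then c.a₁ * s.θ
  else if ‖s.gradModel r u‖ < c.p₂ / s.θ then s.θ
  else max (c.a₂ * s.θ) c.θmin

/-- One iteration of the algorithm, started in the state `s`, with sampled frame `u`, in the case
that the stopping test fails. -/
noncomputable def LMState.next {n m b : ℕ} (c : LMParams)
    (r : EuclideanSpace ℝ (Fin n) → EuclideanSpace ℝ (Fin m))
    (s : LMState n) (u : Fin b → EuclideanSpace ℝ (Fin n)) : LMState n where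
  x := if c.p₀ ≤ s.ratio r u then s.x + s.direction r u else s.x
  θ := s.nextθ c r u
  dPrev := s.direction r u

/-- The state at the beginning of iteration `k`, where `u j` is the frame sampled in iteration `j`,
`x₀` is the starting point, and `dInit` plays the role of `d_{-1}`. It is meaningful as long as the
stopping test has failed in all iterations `j < k`, see `lmReached`. -/
noncomputable def lmState {n m b : ℕ} (c : LMParams)
    (r : EuclideanSpace ℝ (Fin n) → EuclideanSpace ℝ (Fin m))
    (x₀ dInit : EuclideanSpace ℝ (Fin n)) (u : ℕ → Fin b → EuclideanSpace ℝ (Fin n)) :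
    ℕ → LMState n
  | 0 => ⟨x₀, c.θinit, dInit⟩
  | k + 1 => (lmState c r x₀ dInit u k).next c r (u k)

/-- The gradient model `∇ f_{m_k}(x_k)` of iteration `k`. -/
noncomputable def lmGradModel {n m b : ℕ} (c : LMParams)
    (r : EuclideanSpace ℝ (Fin n) → EuclideanSpace ℝ (Fin m))
    (x₀ dInit : EuclideanSpace ℝ (Fin n)) (u : ℕ → Fin b → EuclideanSpace ℝ (Fin n))
    (k : ℕ) : EuclideanSpace ℝ (Fin n) :=
  (lmState c r x₀ dInit u k).gradModel r (u k)

/-- Iteration `k` is reached: the stopping test `‖Jᵀ r(x_j)‖ ≤ ε₀` has failed in all iterations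
`j < k`. -/
def lmReached {n m b : ℕ} (c : LMParams)
    (r : EuclideanSpace ℝ (Fin n) → EuclideanSpace ℝ (Fin m))
    (x₀ dInit : EuclideanSpace ℝ (Fin n)) (u : ℕ → Fin b → EuclideanSpace ℝ (Fin n))
    (k : ℕ) : Prop :=
  ∀ j < k, c.ε₀ < ‖lmGradModel c r x₀ dInit u j‖

/-! ### Probabilistically first-order accurate gradient models -/

/-- The σ-algebra generated by the randomness of all iterations before the `k`-th one, where
`U j` is the random element drawn in iteration `j`. -/
@[reducible] def pastSigma {Ω S : Type*} [MeasurableSpace S] (U : ℕ → Ω → S) (k : ℕ) : MeasurableSpace Ω :=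
  ⨆ j : Fin k, MeasurableSpace.comap (U j) inferInstance

/-- The random gradient models `G k` at the points `X k` are `α`-probabilistically
`(ξ₁, ξ₂)`-first-order accurate: the event
`‖G k - ∇ f (X k)‖ ≤ ξ₁ ‖∇ f (X k)‖ + ξ₂ ‖Dprev k‖` has conditional probability at least `α`, given
the randomness `past k` before iteration `k`, almost surely where iteration `k` is reached.
Here `Dprev k` is the step of iteration `k - 1`. -/
def IsProbFirstOrderAccurate {Ω : Type*} [MeasurableSpace Ω] {n : ℕ} (P : Measure Ω)
    (past : ℕ → MeasurableSpace Ω) (reached : ℕ → Set Ω)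
    (f : EuclideanSpace ℝ (Fin n) → ℝ) (G X Dprev : ℕ → Ω → EuclideanSpace ℝ (Fin n))
    (α ξ₁ ξ₂ : ℝ) : Prop :=
  ∀ k, ∀ᵐ ω ∂P, ω ∈ reached k →
    α ≤ (P⟦{ω' | ‖G k ω' - gradient f (X k ω')‖
      ≤ ξ₁ * ‖gradient f (X k ω')‖ + ξ₂ * ‖Dprev k ω'‖} | past k⟧) ω

/-! Fix a point `x` and a radius `γ > 0`, write `g` for the gradient of the objective at `x` and `U`
for the frame. The gradient model differs from `(n/b) U Uᵀ g` by a deterministic Taylor error of at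
most `(n/2) √m κ_max ‖r x‖ γ` (`norm_modelGradient_sub_le`). Each column of `U` has second moment
matrix `I/n`, so orthonormality gives `E ‖(n/b) U Uᵀ g - g‖² = (n/b - 1) ‖g‖²`, and Markov's
inequality at level `1 - α` bounds this deviation by `ξ₁ ‖g‖` with probability at least `α`
(`le_stiefelUniform_norm_modelGradient_sub_le`).

To use this in iteration `k`, two invariants hold as long as the algorithm has not stopped: `‖r x_k‖
≤ ‖r x₀‖`, since a step is accepted only if the residual decreases, and `d_{k-1} ≠ 0`, so the radius
is positive. Finally, the state is a measurable function of the past frames and the new frame is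
independent of them; hence the conditional probability is the probability of a section, with the
state frozen (`ae_le_condExp_of_indepFun`). -/

/-! ### Second moments of a uniform orthonormal frame. -/

/-- The Haar probability measure of the orthogonal group. -/
noncomputable abbrev orthogonalHaar (n : ℕ) : Measure (Matrix.orthogonalGroup (Fin n) ℝ) :=
  Measure.haarMeasure (⊤ : TopologicalSpace.PositiveCompacts (Matrix.orthogonalGroup (Fin n) ℝ))

instance isProbabilityMeasure_orthogonalHaar (n : ℕ) :
    IsProbabilityMeasure (orthogonalHaar n) :=
  ⟨Measure.haarMeasure_self (K₀ := ⊤)⟩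

theorem continuous_orthogonalGroup_apply {n : ℕ} (i j : Fin n) :
    Continuous fun Q : Matrix.orthogonalGroup (Fin n) ℝ => (Q : Matrix (Fin n) (Fin n) ℝ) i j :=
  continuous_subtype_val.matrix_elem i j

theorem continuous_firstColumns {n b : ℕ} (hbn : b ≤ n) : Continuous (firstColumns hbn) := by
  refine continuous_pi fun j => ?_
  exact (PiLp.continuous_toLp 2 _).comp
    (continuous_pi fun i => continuous_orthogonalGroup_apply i _)

theorem measurable_firstColumns {n b : ℕ} (hbn : b ≤ n) : Measurable (firstColumns hbn) := by
  refine measurable_pi_lambda _ fun j => ?_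
  exact ((continuous_apply j).comp (continuous_firstColumns hbn)).measurable

instance isProbabilityMeasure_stiefelUniform (n b : ℕ) (hbn : b ≤ n) :
    IsProbabilityMeasure (stiefelUniform n b hbn) :=
  Measure.isProbabilityMeasure_map (measurable_firstColumns hbn).aemeasurable

theorem orthonormal_firstColumns {n b : ℕ} (hbn : b ≤ n)
    (Q : Matrix.orthogonalGroup (Fin n) ℝ) : Orthonormal ℝ (firstColumns hbn Q) := by
  rw [orthonormal_iff_ite]
  intro j l
  have h := congrFun (congrFun ((Matrix.mem_orthogonalGroup_iff' (Fin n) ℝ).1 Q.2)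
    (Fin.castLE hbn j)) (Fin.castLE hbn l)
  rw [Matrix.mul_apply, Matrix.one_apply] at h
  simpa [PiLp.inner_apply, firstColumns, Matrix.star_apply, mul_comm] using h

theorem ae_orthonormal_stiefelUniform {n b : ℕ} (hbn : b ≤ n) :
    ∀ᵐ u ∂(stiefelUniform n b hbn), Orthonormal ℝ u := by
  have hs : MeasurableSet {u : Fin b → EuclideanSpace ℝ (Fin n) | Orthonormal ℝ u} := by
    simp only [orthonormal_iff_ite, Set.ofPred_forall]
    exact MeasurableSet.iInter fun j => MeasurableSet.iInter fun l =>
      measurableSet_eq_fun (by fun_prop) measurable_const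
  exact (ae_map_iff (measurable_firstColumns hbn).aemeasurable hs).2
    (ae_of_all _ (orthonormal_firstColumns hbn))

theorem integrable_orthogonalHaar {n : ℕ} {φ : Matrix.orthogonalGroup (Fin n) ℝ → ℝ}
    (hφ : Continuous φ) : Integrable φ (orthogonalHaar n) :=
  hφ.integrable_of_hasCompactSupport (HasCompactSupport.of_compactSpace φ)

/-- Mixed second moments within a column vanish. -/
theorem integral_orthogonal_mul_of_ne {n : ℕ} {i k : Fin n} (hik : i ≠ k) (j : Fin n) :
    ∫ Q, (Q : Matrix (Fin n) (Fin n) ℝ) i j * (Q : Matrix (Fin n) (Fin n) ℝ) k j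
      ∂(orthogonalHaar n) = 0 := by
  classical
  -- Left multiplication by `D` flips the sign of row `i` only, so by Haar invariance the integral
  -- equals its own negative.
  let D : Matrix (Fin n) (Fin n) ℝ := Matrix.diagonal fun l => if l = i then -1 else 1
  have hD : D ∈ Matrix.orthogonalGroup (Fin n) ℝ := by
    rw [Matrix.mem_orthogonalGroup_iff, Matrix.diagonal_transpose,
      Matrix.diagonal_mul_diagonal, ← Matrix.diagonal_one]
    congr 1
    ext l
    by_cases h : l = i <;> simp [h]
  have h := integral_mul_left_eq_self (μ := orthogonalHaar n)
    (fun Q => (Q : Matrix (Fin n) (Fin n) ℝ) i j * (Q : Matrix (Fin n) (Fin n) ℝ) k j) ⟨D, hD⟩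
  simp only [Submonoid.coe_mul, D, Matrix.diagonal_mul, if_true, if_neg hik.symm, one_mul,
    neg_mul, integral_neg] at h
  linarith

/-- The second moments within a column agree. -/
theorem integral_orthogonal_sq_eq {n : ℕ} (i k j : Fin n) :
    ∫ Q, (Q : Matrix (Fin n) (Fin n) ℝ) i j ^ 2 ∂(orthogonalHaar n)
      = ∫ Q, (Q : Matrix (Fin n) (Fin n) ℝ) k j ^ 2 ∂(orthogonalHaar n) := by
  -- Left multiplication by `S` exchanges rows `i` and `k` and preserves Haar measure.
  let S : Matrix (Fin n) (Fin n) ℝ := (Equiv.swap i k).permMatrix ℝ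
  have hS : S ∈ Matrix.orthogonalGroup (Fin n) ℝ := by
    rw [Matrix.mem_orthogonalGroup_iff, Matrix.transpose_permMatrix,
      ← Matrix.permMatrix_mul]
    simp
  have h := integral_mul_left_eq_self (μ := orthogonalHaar n)
    (fun Q => (Q : Matrix (Fin n) (Fin n) ℝ) k j ^ 2) ⟨S, hS⟩
  simpa only [Submonoid.coe_mul, S, PEquiv.toMatrix_toPEquiv_mul, Matrix.submatrix_apply,
    Equiv.swap_apply_right, id] using h

/-- The `n` entries of a column have equal second moments, and their squares sum to one. -/
theorem integral_orthogonal_sq {n : ℕ} (i j : Fin n) :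
    ∫ Q, (Q : Matrix (Fin n) (Fin n) ℝ) i j ^ 2 ∂(orthogonalHaar n) = 1 / n := by
  have hn : (n : ℝ) ≠ 0 := by
    have := i.pos
    positivity
  have hsum : ∑ l, ∫ Q, (Q : Matrix (Fin n) (Fin n) ℝ) l j ^ 2 ∂(orthogonalHaar n) = 1 := by
    have hint (l : Fin n) : Integrable (fun Q : Matrix.orthogonalGroup (Fin n) ℝ =>
        (Q : Matrix (Fin n) (Fin n) ℝ) l j ^ 2) (orthogonalHaar n) :=
      integrable_orthogonalHaar ((continuous_orthogonalGroup_apply l j).pow 2)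
    rw [← integral_finsetSum _ fun l _ => hint l]
    have h (Q : Matrix.orthogonalGroup (Fin n) ℝ) :
        ∑ l, (Q : Matrix (Fin n) (Fin n) ℝ) l j ^ 2 = 1 := by
      have := congrFun (congrFun ((Matrix.mem_orthogonalGroup_iff' (Fin n) ℝ).1 Q.2) j) j
      rw [Matrix.mul_apply, Matrix.one_apply_eq] at this
      simpa [Matrix.star_apply, pow_two] using this
    simp [h]
  rw [Finset.sum_congr rfl fun l _ => integral_orthogonal_sq_eq l i j] at hsum
  simp only [Finset.sum_const, Finset.card_univ, Fintype.card_fin, nsmul_eq_mul] at hsum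
  rw [eq_div_iff hn, mul_comm, hsum]

/-- Each vector of a uniform orthonormal frame of `ℝⁿ` has covariance `1 / n` times the identity. -/
theorem integral_inner_sq_stiefelUniform {n b : ℕ} (hbn : b ≤ n) (j : Fin b)
    (g : EuclideanSpace ℝ (Fin n)) :
    ∫ u, (inner ℝ (u j) g) ^ 2 ∂(stiefelUniform n b hbn) = ‖g‖ ^ 2 / n := by
  have hc (i k : Fin n) : Integrable (fun Q : Matrix.orthogonalGroup (Fin n) ℝ =>
      g i * g k * ((Q : Matrix (Fin n) (Fin n) ℝ) i (Fin.castLE hbn j)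
        * (Q : Matrix (Fin n) (Fin n) ℝ) k (Fin.castLE hbn j))) (orthogonalHaar n) :=
    integrable_orthogonalHaar (continuous_const.mul
      ((continuous_orthogonalGroup_apply _ _).mul (continuous_orthogonalGroup_apply _ _)))
  have hm (i k : Fin n) : ∫ Q, (Q : Matrix (Fin n) (Fin n) ℝ) i (Fin.castLE hbn j)
      * (Q : Matrix (Fin n) (Fin n) ℝ) k (Fin.castLE hbn j) ∂(orthogonalHaar n)
      = if i = k then 1 / (n : ℝ) else 0 := by
    split_ifs with h
    · subst h
      simpa only [pow_two] using integral_orthogonal_sq i (Fin.castLE hbn j)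
    · exact integral_orthogonal_mul_of_ne h _
  have hexp (Q : Matrix.orthogonalGroup (Fin n) ℝ) :
      (inner ℝ (firstColumns hbn Q j) g) ^ 2 = ∑ i, ∑ k, g i * g k *
        ((Q : Matrix (Fin n) (Fin n) ℝ) i (Fin.castLE hbn j)
        * (Q : Matrix (Fin n) (Fin n) ℝ) k (Fin.castLE hbn j)) := by
    simp only [PiLp.inner_apply, firstColumns, RCLike.inner_apply, conj_trivial, pow_two,
      Finset.sum_mul_sum]
    exact Finset.sum_congr rfl fun i _ => Finset.sum_congr rfl fun k _ => by ring
  rw [stiefelUniform, integral_map (measurable_firstColumns hbn).aemeasurable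
    (by fun_prop : Measurable fun u : Fin b → EuclideanSpace ℝ (Fin n) =>
      (inner ℝ (u j) g) ^ 2).aestronglyMeasurable]
  simp only [hexp]
  rw [integral_finsetSum _ fun i _ => integrable_finsetSum _ fun k _ => hc i k]
  simp only [integral_finsetSum _ fun k _ => hc _ k, integral_const_mul, hm,
    EuclideanSpace.norm_sq_eq, Real.norm_eq_abs, sq_abs]
  simp [Finset.sum_mul, pow_two, div_eq_mul_inv]

/-! ### Bias and variance of the gradient model at a fixed point. -/

/-- The first order Taylor estimate for a function with Lipschitz gradient. -/
theorem abs_sub_sub_inner_gradient_le {E : Type*} [NormedAddCommGroup E] [InnerProductSpace ℝ E]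
    [CompleteSpace E] {φ : E → ℝ} (hφ : Differentiable ℝ φ) {K : ℝ} {x : E}
    (hK : ∀ y, ‖gradient φ y - gradient φ x‖ ≤ K * ‖y - x‖) (v : E) :
    |φ (x + v) - φ x - inner ℝ (gradient φ x) v| ≤ K / 2 * ‖v‖ ^ 2 := by
  -- The Taylor remainder along the segment; its derivative is at most `K ‖v‖² t`, so it is
  -- dominated by `K / 2 * ‖v‖ ^ 2 * t ^ 2` on `[0, 1]`.
  let f : ℝ → ℝ := fun t => φ (x + t • v) - φ x - t * inner ℝ (gradient φ x) v
  have hf (t : ℝ) : HasDerivAt f (inner ℝ (gradient φ (x + t • v) - gradient φ x) v) t := by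
    have hl : HasDerivAt (fun t : ℝ => x + t • v) v t := by
      simpa using ((hasDerivAt_id t).smul_const v).const_add x
    have h1 := (hφ (x + t • v)).hasGradientAt.hasFDerivAt.comp_hasDerivAt t hl
    have h2 := (h1.sub_const (φ x)).sub
      ((hasDerivAt_id t).mul_const (inner ℝ (gradient φ x) v))
    simpa [f, inner_sub_left, Pi.sub_def, Function.comp_def] using h2
  have hB (t : ℝ) : HasDerivAt (fun t : ℝ => K / 2 * ‖v‖ ^ 2 * t ^ 2) (K * ‖v‖ ^ 2 * t) t := by
    refine ((hasDerivAt_pow 2 t).const_mul (K / 2 * ‖v‖ ^ 2)).congr_deriv ?_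
    push_cast
    ring
  have h := image_norm_le_of_norm_deriv_right_le_deriv_boundary (a := 0) (b := 1)
    (fun t _ => (hf t).continuousAt.continuousWithinAt)
    (fun t _ => (hf t).hasDerivWithinAt) (B := fun t : ℝ => K / 2 * ‖v‖ ^ 2 * t ^ 2)
    (by simp [f]) hB (fun t ht => by
      calc ‖inner ℝ (gradient φ (x + t • v) - gradient φ x) v‖
          ≤ ‖gradient φ (x + t • v) - gradient φ x‖ * ‖v‖ := norm_inner_le_norm _ _
        _ ≤ K * ‖x + t • v - x‖ * ‖v‖ := by gcongr; exact hK _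
        _ = K * ‖v‖ ^ 2 * t := by
          rw [add_sub_cancel_left, norm_smul, Real.norm_of_nonneg ht.1]
          ring) (Set.right_mem_Icc.2 zero_le_one)
  simpa [f, Real.norm_eq_abs] using h

section Model

variable {n m b : ℕ} {r : EuclideanSpace ℝ (Fin n) → EuclideanSpace ℝ (Fin m)}

theorem hasGradientAt_lsObjective (hr : Differentiable ℝ r) (x : EuclideanSpace ℝ (Fin n)) :
    HasGradientAt (lsObjective r) (∑ i, r x i • gradient (fun z => r z i) x) x := by
  have hi (i : Fin m) : HasFDerivAt (fun z => r z i)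
      (InnerProductSpace.toDual ℝ _ (gradient (fun z => r z i) x)) x :=
    ((differentiable_euclidean.1 hr i) x).hasGradientAt.hasFDerivAt
  have h := (HasFDerivAt.fun_sum (u := Finset.univ) fun i _ => (hi i).pow 2).const_mul (1 / 2)
  rw [hasGradientAt_iff_hasFDerivAt]
  refine h.congr_fderiv ?_
  ext v
  simp only [map_sum, map_smulₛₗ, sum_apply, smul_apply,
    Finset.mul_sum, smul_eq_mul, RCLike.conj_to_real]
  exact Finset.sum_congr rfl fun i _ => by
    simp
    ring

theorem gradient_lsObjective (hr : Differentiable ℝ r) (x : EuclideanSpace ℝ (Fin n)) :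
    gradient (lsObjective r) x = ∑ i, r x i • gradient (fun z => r z i) x :=
  (hasGradientAt_lsObjective hr x).gradient

/-- Interchanging the sums over residuals and frame vectors puts the model in the shape of `(n/b) U
Uᵀ g`, difference quotients taking the place of `⟨u j, g⟩`. -/
theorem modelGradient_smoothedJacobian (γ : ℝ) (u : Fin b → EuclideanSpace ℝ (Fin n))
    (x : EuclideanSpace ℝ (Fin n)) :
    modelGradient r (smoothedJacobian r γ u x) x
      = ((n : ℝ) / b) • ∑ j, (∑ i, r x i * ((r (x + γ • u j) i - r x i) / γ)) • u j := by
  ext l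
  simp only [modelGradient, smoothedJacobian, smoothedGrad, Matrix.mulVec, dotProduct,
    Matrix.transpose_apply, Matrix.of_apply, PiLp.smul_apply, WithLp.ofLp_sum,
    Finset.sum_apply, WithLp.ofLp_smul, Pi.smul_apply, smul_eq_mul, Finset.sum_mul,
    Finset.mul_sum]
  rw [Finset.sum_comm]
  exact Finset.sum_congr rfl fun i _ => Finset.sum_congr rfl fun k _ => by ring

/-- Cauchy–Schwarz; this is the source of the factor `√m` in `ξ₂`. -/
theorem sum_abs_le_sqrt_card_mul_norm (y : EuclideanSpace ℝ (Fin m)) :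
    ∑ i, |y i| ≤ Real.sqrt m * ‖y‖ := by
  have h := sq_sum_le_card_mul_sum_sq (s := Finset.univ) (f := fun i : Fin m => |y i|)
  rw [EuclideanSpace.norm_eq, ← Real.sqrt_mul (Nat.cast_nonneg m)]
  refine Real.le_sqrt_of_sq_le ?_
  simpa using h

/-- The bias of orthogonal spherical smoothing. -/
theorem norm_modelGradient_sub_le (hr : Differentiable ℝ r) {K : ℝ} (hK : 0 ≤ K)
    {x : EuclideanSpace ℝ (Fin n)}
    (hgrad : ∀ i y, ‖gradient (fun z => r z i) y - gradient (fun z => r z i) x‖ ≤ K * ‖y - x‖)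
    {γ : ℝ} (hγ : 0 < γ) {u : Fin b → EuclideanSpace ℝ (Fin n)} (hu : ∀ j, ‖u j‖ = 1) :
    ‖modelGradient r (smoothedJacobian r γ u x) x
      - ((n : ℝ) / b) • ∑ j, inner ℝ (u j) (gradient (lsObjective r) x) • u j‖
      ≤ n / 2 * (Real.sqrt m * K * ‖r x‖ * γ) := by
  have hT (i : Fin m) (j : Fin b) : |(r (x + γ • u j) i - r x i) / γ
      - inner ℝ (u j) (gradient (fun z => r z i) x)| ≤ K / 2 * γ := by
    have h := abs_sub_sub_inner_gradient_le (differentiable_euclidean.1 hr i) (hgrad i) (γ • u j)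
    rw [norm_smul, hu, inner_smul_right, Real.norm_of_nonneg hγ.le, mul_one,
      real_inner_comm] at h
    have he : (r (x + γ • u j) i - r x i) / γ - inner ℝ (u j) (gradient (fun z => r z i) x)
        = (r (x + γ • u j) i - r x i - γ * inner ℝ (u j) (gradient (fun z => r z i) x)) / γ := by
      field_simp
    rw [he, abs_div, abs_of_pos hγ, div_le_iff₀ hγ]
    linarith
  have hE (j : Fin b) : ‖(∑ i, r x i * ((r (x + γ • u j) i - r x i) / γ)
      - inner ℝ (u j) (gradient (lsObjective r) x)) • u j‖
      ≤ Real.sqrt m * ‖r x‖ * (K / 2 * γ) := by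
    rw [norm_smul, hu, mul_one, gradient_lsObjective hr, inner_sum, ← Finset.sum_sub_distrib]
    simp only [inner_smul_right, ← mul_sub]
    calc _ ≤ ∑ i, |r x i| * (K / 2 * γ) := by
          refine (norm_sum_le _ _).trans (Finset.sum_le_sum fun i _ => ?_)
          rw [norm_mul]
          exact mul_le_mul_of_nonneg_left (hT i j) (norm_nonneg _)
      _ ≤ _ := by
          rw [← Finset.sum_mul]
          gcongr
          exact sum_abs_le_sqrt_card_mul_norm _
  rw [modelGradient_smoothedJacobian, ← smul_sub, ← Finset.sum_sub_distrib]
  simp only [← sub_smul]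
  rw [norm_smul, Real.norm_of_nonneg (by positivity)]
  calc _ ≤ (n : ℝ) / b * (b * (Real.sqrt m * ‖r x‖ * (K / 2 * γ))) := by
        gcongr
        simpa using norm_sum_le_of_le Finset.univ fun j _ => hE j
    _ ≤ n * (Real.sqrt m * ‖r x‖ * (K / 2 * γ)) := by
        rw [← mul_assoc]
        gcongr
        -- An empty frame is allowed here: then `n / b * b` is `0` and the bound still holds.
        rcases eq_or_ne (b : ℝ) 0 with h0 | h0
        · simp [h0]
        · rw [div_mul_cancel₀ _ h0]
    _ = _ := by ring

/-- `U Uᵀ` is an orthogonal projection, so `‖U Uᵀ g‖²` and `⟨U Uᵀ g, g⟩` are the same sum of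
squares. -/
theorem norm_sq_smul_sum_inner_smul_sub {u : Fin b → EuclideanSpace ℝ (Fin n)}
    (hu : Orthonormal ℝ u) (a : ℝ) (g : EuclideanSpace ℝ (Fin n)) :
    ‖a • ∑ j, inner ℝ (u j) g • u j - g‖ ^ 2
      = (a ^ 2 - 2 * a) * ∑ j, inner ℝ (u j) g ^ 2 + ‖g‖ ^ 2 := by
  have h1 : ‖∑ j, inner ℝ (u j) g • u j‖ ^ 2 = ∑ j, inner ℝ (u j) g ^ 2 := by
    rw [← real_inner_self_eq_norm_sq, hu.inner_sum]
    simp [pow_two]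
  have h2 : inner ℝ (∑ j, inner ℝ (u j) g • u j) g = ∑ j, inner ℝ (u j) g ^ 2 := by
    simp [sum_inner, inner_smul_left, pow_two]
  rw [norm_sub_sq_real, norm_smul, mul_pow, h1, inner_smul_left, h2, Real.norm_eq_abs, sq_abs]
  simp
  ring

/-- The sum of squares has mean `(b/n) ‖g‖²`, and `((n/b)² - 2 n/b) (b/n) + 1 = n/b - 1`. No moments
linking different columns are needed. -/
theorem integral_norm_sq_smul_sum_inner_smul_sub (hb : 1 ≤ b) (hbn : b ≤ n)
    (g : EuclideanSpace ℝ (Fin n)) :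
    Integrable (fun u : Fin b → EuclideanSpace ℝ (Fin n) =>
      ‖((n : ℝ) / b) • ∑ j, inner ℝ (u j) g • u j - g‖ ^ 2) (stiefelUniform n b hbn) ∧
    ∫ u, ‖((n : ℝ) / b) • ∑ j, inner ℝ (u j) g • u j - g‖ ^ 2 ∂(stiefelUniform n b hbn)
      = ((n : ℝ) / b - 1) * ‖g‖ ^ 2 := by
  have hb0 : (b : ℝ) ≠ 0 := by positivity
  have hn0 : (n : ℝ) ≠ 0 := by
    have : 1 ≤ n := hb.trans hbn
    positivity
  have hint (j : Fin b) : Integrable (fun u : Fin b → EuclideanSpace ℝ (Fin n) =>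
      inner ℝ (u j) g ^ 2) (stiefelUniform n b hbn) := by
    refine Integrable.of_bound (C := ‖g‖ ^ 2)
      (by fun_prop : Measurable fun u : Fin b → EuclideanSpace ℝ (Fin n) =>
        inner ℝ (u j) g ^ 2).aestronglyMeasurable ?_
    filter_upwards [ae_orthonormal_stiefelUniform hbn] with u hu
    rw [norm_pow]
    gcongr
    simpa [hu.1 j] using norm_inner_le_norm (𝕜 := ℝ) (u j) g
  have hae : (fun u : Fin b → EuclideanSpace ℝ (Fin n) =>
      ‖((n : ℝ) / b) • ∑ j, inner ℝ (u j) g • u j - g‖ ^ 2) =ᵐ[stiefelUniform n b hbn]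
      fun u => (((n : ℝ) / b) ^ 2 - 2 * (n / b)) * ∑ j, inner ℝ (u j) g ^ 2 + ‖g‖ ^ 2 := by
    filter_upwards [ae_orthonormal_stiefelUniform hbn] with u hu
    exact norm_sq_smul_sum_inner_smul_sub hu _ g
  have hsum := integrable_finsetSum (Finset.univ : Finset (Fin b)) fun j _ => hint j
  refine ⟨(integrable_congr hae).2 ((hsum.const_mul _).add (integrable_const _)), ?_⟩
  rw [integral_congr_ae hae, integral_add (hsum.const_mul _) (integrable_const _),
    integral_const_mul, integral_finsetSum _ fun j _ => hint j]
  simp only [integral_inner_sq_stiefelUniform, Finset.sum_const, Finset.card_univ,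
    Fintype.card_fin, nsmul_eq_mul, integral_const, probReal_univ, one_smul]
  field_simp
  ring

end Model

/-! ### From the second moment to a probability bound. -/

/-- Markov's inequality in the form of a lower bound for the probability of small values. -/
theorem one_sub_le_measureReal_le_integral_div {S : Type*} [MeasurableSpace S] {μ : Measure S}
    [IsProbabilityMeasure μ] {V : S → ℝ} (hV : 0 ≤ V) (hint : Integrable V μ) {δ : ℝ}
    (hδ : 0 < δ) : 1 - δ ≤ μ.real {u | V u ≤ (∫ u, V u ∂μ) / δ} := by
  -- With zero mean the threshold is zero and Markov's inequality says nothing; but then `V`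
  -- vanishes almost everywhere.
  rcases (integral_nonneg hV).eq_or_lt with h0 | hpos
  · have hz := (integral_eq_zero_iff_of_nonneg hV hint).1 h0.symm
    have h1 : μ.real {u | V u ≤ (∫ u, V u ∂μ) / δ} = 1 := by
      have hae : ∀ᵐ u ∂μ, u ∈ {u | V u ≤ (∫ u, V u ∂μ) / δ} := by
        filter_upwards [hz] with u hu
        rw [← h0, zero_div]
        exact hu.le
      rw [measureReal_def]
      erw [measure_of_measure_compl_eq_zero hae, measure_univ, ENNReal.toReal_one]
    linarith
  · have ht : 0 < (∫ u, V u ∂μ) / δ := div_pos hpos hδ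
    have hM := mul_meas_ge_le_integral_of_nonneg (ae_of_all _ hV) hint ((∫ u, V u ∂μ) / δ)
    have hle : μ.real {u | (∫ u, V u ∂μ) / δ ≤ V u} ≤ δ := by
      rw [div_mul_eq_mul_div, div_le_iff₀ hδ] at hM
      exact le_of_mul_le_mul_left hM hpos
    have hun : (Set.univ : Set S) ⊆ {u | V u ≤ (∫ u, V u ∂μ) / δ} ∪
        {u | (∫ u, V u ∂μ) / δ ≤ V u} := fun u _ => le_total (V u) _
    have := (measureReal_mono (μ := μ) hun).trans (measureReal_union_le _ _)
    rw [probReal_univ] at this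
    linarith

/-- First order accuracy of the smoothed gradient model at a fixed point. -/
theorem le_stiefelUniform_norm_modelGradient_sub_le {n m b : ℕ} (hb : 1 ≤ b) (hbn : b ≤ n)
    {r : EuclideanSpace ℝ (Fin n) → EuclideanSpace ℝ (Fin m)} (hr : Differentiable ℝ r)
    {K : ℝ} (hK : 0 ≤ K) {x : EuclideanSpace ℝ (Fin n)}
    (hgrad : ∀ i y, ‖gradient (fun z => r z i) y - gradient (fun z => r z i) x‖ ≤ K * ‖y - x‖)
    {γ : ℝ} (hγ : 0 < γ) {α : ℝ} (hα : α < 1) :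
    α ≤ (stiefelUniform n b hbn).real {u |
      ‖modelGradient r (smoothedJacobian r γ u x) x - gradient (lsObjective r) x‖
        ≤ Real.sqrt (((n : ℝ) / b - 1) / (1 - α)) * ‖gradient (lsObjective r) x‖
          + n / 2 * (Real.sqrt m * K * ‖r x‖ * γ)} := by
  set g := gradient (lsObjective r) x with hg
  obtain ⟨hint, hV⟩ := integral_norm_sq_smul_sum_inner_smul_sub hb hbn g
  have hδ : 0 < 1 - α := by linarith
  have hM := one_sub_le_measureReal_le_integral_div (fun u => sq_nonneg _) hint hδ
  rw [hV, sub_sub_cancel] at hM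
  refine hM.trans ?_
  refine ENNReal.toReal_mono (measure_ne_top _ _) (measure_mono_ae ?_)
  filter_upwards [ae_orthonormal_stiefelUniform hbn] with u hu hle
  have h1 : ‖((n : ℝ) / b) • ∑ j, inner ℝ (u j) g • u j - g‖
      ≤ Real.sqrt (((n : ℝ) / b - 1) / (1 - α)) * ‖g‖ := by
    rw [← Real.sqrt_sq (norm_nonneg g), ← Real.sqrt_mul' _ (sq_nonneg _)]
    refine Real.le_sqrt_of_sq_le ?_
    rw [div_mul_eq_mul_div]
    exact hle
  have h2 := norm_modelGradient_sub_le hr hK hgrad hγ hu.1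
  rw [← hg] at h2
  have := norm_sub_le_norm_sub_add_norm_sub (modelGradient r (smoothedJacobian r γ u x) x)
    (((n : ℝ) / b) • ∑ j, inner ℝ (u j) g • u j) g
  exact this.trans (by linarith)

/-! ### Deterministic invariants of the algorithm. -/

section Algorithm

variable {n m b : ℕ} {c : LMParams} {r : EuclideanSpace ℝ (Fin n) → EuclideanSpace ℝ (Fin m)}

/-- A regularized Gauss-Newton step does not increase the norm of the linear model. -/
theorem norm_add_mulVec_sq_le (J : Matrix (Fin m) (Fin n) ℝ) (y : EuclideanSpace ℝ (Fin m))
    {lam : ℝ} (hlam : 0 ≤ lam) {d : EuclideanSpace ℝ (Fin n)}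
    (hd : (J.transpose * J + lam • (1 : Matrix (Fin n) (Fin n) ℝ)).mulVec d.ofLp
      = -(J.transpose.mulVec y.ofLp)) :
    ‖y + WithLp.toLp 2 (J.mulVec d.ofLp)‖ ^ 2 ≤ ‖y‖ ^ 2 := by
  -- Pairing the equation with `d` gives `‖J d‖² + λ ‖d‖² = -⟨J d, y⟩`, hence `‖y + J d‖² = ‖y‖² -
  -- ‖J d‖² - 2 λ ‖d‖²`.
  have h := congrArg (fun v => d.ofLp ⬝ᵥ v) hd
  simp only [Matrix.add_mulVec, Matrix.smul_mulVec, Matrix.one_mulVec, dotProduct_add,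
    dotProduct_smul, dotProduct_neg, ← Matrix.mulVec_mulVec, Matrix.dotProduct_mulVec,
    Matrix.vecMul_transpose, smul_eq_mul] at h
  rw [← Matrix.dotProduct_mulVec] at h
  have h1 : 0 ≤ J.mulVec d.ofLp ⬝ᵥ J.mulVec d.ofLp :=
    Finset.sum_nonneg fun _ _ => mul_self_nonneg _
  have h2 : 0 ≤ d.ofLp ⬝ᵥ d.ofLp :=
    Finset.sum_nonneg fun _ _ => mul_self_nonneg _
  have h3 : ‖WithLp.toLp 2 (J.mulVec d.ofLp)‖ ^ 2 = J.mulVec d.ofLp ⬝ᵥ J.mulVec d.ofLp := by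
    rw [EuclideanSpace.norm_sq_eq]
    simp [dotProduct, pow_two]
  have h4 : inner ℝ y (WithLp.toLp 2 (J.mulVec d.ofLp)) = J.mulVec d.ofLp ⬝ᵥ y.ofLp := by
    simp [PiLp.inner_apply, dotProduct]
  rw [norm_add_sq_real, h3, h4]
  nlinarith [mul_nonneg hlam h2]

theorem posDef_transpose_mul_self_add_smul_one (J : Matrix (Fin m) (Fin n) ℝ) {lam : ℝ}
    (hlam : 0 < lam) :
    (J.transpose * J + lam • (1 : Matrix (Fin n) (Fin n) ℝ)).PosDef := by
  have h := Matrix.posSemidef_conjTranspose_mul_self J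
  rw [Matrix.conjTranspose_eq_transpose_of_trivial] at h
  exact Matrix.PosDef.posSemidef_add h (Matrix.PosDef.one.smul hlam)

namespace LMState

variable (s : LMState n) (u : Fin b → EuclideanSpace ℝ (Fin n))

theorem mulVec_direction (hs : 0 < s.θ) (hg : s.gradModel r u ≠ 0) :
    ((s.jacobian r u).transpose * s.jacobian r u
      + (s.θ * ‖s.gradModel r u‖) • (1 : Matrix (Fin n) (Fin n) ℝ)).mulVec
        (s.direction r u).ofLp = -(s.gradModel r u).ofLp := by
  have hdet := (posDef_transpose_mul_self_add_smul_one (s.jacobian r u)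
    (mul_pos hs (norm_pos_iff.2 hg))).isUnit
  rw [Matrix.isUnit_iff_isUnit_det] at hdet
  simp only [direction, Matrix.mulVec_neg, Matrix.mulVec_mulVec, Matrix.mul_nonsing_inv _ hdet,
    Matrix.one_mulVec]

/-- A zero step would force a zero right-hand side. This keeps the next smoothing radius positive.
-/
theorem direction_ne_zero (hs : 0 < s.θ) (hg : s.gradModel r u ≠ 0) :
    s.direction r u ≠ 0 := by
  intro h
  have h1 := s.mulVec_direction u hs hg
  rw [h, WithLp.ofLp_zero, Matrix.mulVec_zero, eq_comm, neg_eq_zero] at h1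
  exact hg ((WithLp.ofLp_eq_zero 2).1 h1)

theorem norm_residual_next_le (hc : c.Valid) (hs : 0 < s.θ) (hg : s.gradModel r u ≠ 0) :
    ‖r (s.next c r u).x‖ ≤ ‖r s.x‖ := by
  by_cases h : c.p₀ ≤ s.ratio r u
  · simp only [next, if_pos h]
    have hden := norm_add_mulVec_sq_le (s.jacobian r u) (r s.x)
      (mul_pos hs (norm_pos_iff.2 hg)).le (s.mulVec_direction u hs hg)
    have hpos : 0 < s.ratio r u := hc.2.2.2.2.1.trans_le h
    -- The predicted reduction is nonnegative, so a positive ratio forces a positive actual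
    -- reduction.
    have hnum := ((div_pos_iff.1 hpos).resolve_right fun h' =>
      (sub_nonneg.2 hden).not_gt h'.2).1
    exact (pow_le_pow_iff_left₀ (norm_nonneg _) (norm_nonneg _) two_ne_zero).1
      (sub_pos.1 hnum).le
  · simp only [next, if_neg h, le_refl]

theorem nextθ_pos (hc : c.Valid) (hs : 0 < s.θ) : 0 < s.nextθ c r u := by
  obtain ⟨h1, -, -, -, -, -, -, -, h2, -⟩ := hc
  have : 0 < c.a₁ * s.θ := mul_pos (one_pos.trans h1) hs
  unfold nextθ
  split_ifs
  exacts [this, this, hs, lt_max_of_lt_right h2]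

end LMState

variable {x₀ dInit : EuclideanSpace ℝ (Fin n)} {u : ℕ → Fin b → EuclideanSpace ℝ (Fin n)}

theorem lmState_θ_pos (hc : c.Valid) (k : ℕ) : 0 < (lmState c r x₀ dInit u k).θ := by
  induction k with
  | zero =>
    obtain ⟨-, -, -, -, -, -, -, -, h1, h2, -⟩ := hc
    exact h1.trans_le h2
  | succ k ih => exact LMState.nextθ_pos _ _ hc ih

theorem gradModel_ne_zero_of_lmReached (hc : c.Valid) {k j : ℕ}
    (h : lmReached c r x₀ dInit u k) (hj : j < k) :
    (lmState c r x₀ dInit u j).gradModel r (u j) ≠ 0 :=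
  norm_pos_iff.1 (hc.2.2.2.2.2.2.2.2.2.2.trans_lt (h j hj))

theorem norm_residual_lmState_le (hc : c.Valid) {k : ℕ} (h : lmReached c r x₀ dInit u k) :
    ‖r (lmState c r x₀ dInit u k).x‖ ≤ ‖r x₀‖ := by
  induction k with
  | zero => exact le_rfl
  | succ k ih =>
    exact (LMState.norm_residual_next_le _ _ hc (lmState_θ_pos hc k)
      (gradModel_ne_zero_of_lmReached hc h k.lt_succ_self)).trans
        (ih fun j hj => h j (hj.trans k.lt_succ_self))

theorem lmState_dPrev_ne_zero (hc : c.Valid) (hd : dInit ≠ 0) {k : ℕ}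
    (h : lmReached c r x₀ dInit u k) : (lmState c r x₀ dInit u k).dPrev ≠ 0 := by
  cases k with
  | zero => exact hd
  | succ k =>
    exact LMState.direction_ne_zero _ _ (lmState_θ_pos hc k)
      (gradModel_ne_zero_of_lmReached hc h k.lt_succ_self)

/-- The state before iteration `k` depends only on the frames sampled before iteration `k`. -/
theorem lmState_congr {v : ℕ → Fin b → EuclideanSpace ℝ (Fin n)} {k : ℕ}
    (h : ∀ j < k, u j = v j) : lmState c r x₀ dInit u k = lmState c r x₀ dInit v k := by
  induction k with
  | zero => rfl
  | succ k ih =>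
    simp only [lmState, ih fun j hj => h j (hj.trans k.lt_succ_self), h k k.lt_succ_self]

theorem lmReached_congr {v : ℕ → Fin b → EuclideanSpace ℝ (Fin n)} {k : ℕ}
    (h : ∀ j < k, u j = v j) : lmReached c r x₀ dInit u k ↔ lmReached c r x₀ dInit v k := by
  refine forall₂_congr fun j hj => ?_
  rw [lmGradModel, lmGradModel, lmState_congr fun i hi => h i (hi.trans hj), h j hj]

end Algorithm

/-! ### Measurable dependence of the state on the frames. -/

section Measurability

variable {n m b : ℕ} {r : EuclideanSpace ℝ (Fin n) → EuclideanSpace ℝ (Fin m)}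
  {T : Type*} [MeasurableSpace T]

theorem measurable_matrix_det {k : ℕ} {A : T → Matrix (Fin k) (Fin k) ℝ}
    (hA : ∀ i j, Measurable fun t => A t i j) : Measurable fun t => (A t).det := by
  simp only [Matrix.det_apply']
  fun_prop

theorem measurable_matrix_inv {k : ℕ} {A : T → Matrix (Fin k) (Fin k) ℝ}
    (hA : ∀ i j, Measurable fun t => A t i j) (i j : Fin k) :
    Measurable fun t => (A t)⁻¹ i j := by
  simp only [Matrix.inv_def, Matrix.smul_apply, Ring.inverse_eq_inv', smul_eq_mul,
    Matrix.adjugate_apply]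
  -- By Cramer's rule an entry of the inverse is a quotient of determinants, the numerator having
  -- row `j` replaced by a constant unit vector. Singular matrices need no separate case, as both
  -- inverses are then zero.
  refine (measurable_matrix_det hA).inv.mul (measurable_matrix_det fun a l => ?_)
  by_cases h : a = j
  · subst h
    simp
  · simpa [Matrix.updateRow_ne h] using hA a l

theorem measurable_toLp {k : ℕ} {f : T → Fin k → ℝ} (hf : ∀ i, Measurable fun t => f t i) :
    Measurable fun t => (WithLp.toLp 2 (f t) : EuclideanSpace ℝ (Fin k)) :=
  (PiLp.continuous_toLp 2 _).measurable.comp (measurable_pi_lambda _ hf)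

theorem Measurable.euclideanSpace_apply {k : ℕ} {f : T → EuclideanSpace ℝ (Fin k)}
    (hf : Measurable f) (i : Fin k) : Measurable fun t => f t i :=
  (PiLp.continuous_apply 2 _ i).measurable.comp hf

/-- Componentwise measurability of a random state. -/
def MeasurableState (s : T → LMState n) : Prop :=
  Measurable (fun t => (s t).x) ∧ Measurable (fun t => (s t).θ) ∧
    Measurable (fun t => (s t).dPrev)

variable {s : T → LMState n} {u : T → Fin b → EuclideanSpace ℝ (Fin n)}

theorem MeasurableState.jacobian (hr : Measurable r) (hs : MeasurableState s)
    (hu : Measurable u) (i : Fin m) (l : Fin n) :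
    Measurable fun t => (s t).jacobian r (u t) i l := by
  obtain ⟨hx, -, hd⟩ := hs
  have hu' (j : Fin b) : Measurable fun t => u t j := hu.eval
  have h1 (j : Fin b) : Measurable fun t => r ((s t).x + ‖(s t).dPrev‖ • u t j) i :=
    (hr.comp (hx.add (hd.norm.smul (hu' j)))).euclideanSpace_apply i
  have h2 : Measurable fun t => r (s t).x i := (hr.comp hx).euclideanSpace_apply i
  simp only [LMState.jacobian, smoothedJacobian, Matrix.of_apply, smoothedGrad]
  have h3 : Measurable fun t => ∑ j, ((r ((s t).x + ‖(s t).dPrev‖ • u t j) i - r (s t).x i)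
      / ‖(s t).dPrev‖) • u t j :=
    Finset.measurable_fun_sum _ fun j _ => (((h1 j).sub h2).div hd.norm).smul (hu' j)
  exact (h3.const_smul ((n : ℝ) / b)).euclideanSpace_apply l

theorem MeasurableState.gradModel (hr : Measurable r) (hs : MeasurableState s)
    (hu : Measurable u) : Measurable fun t => (s t).gradModel r (u t) := by
  refine measurable_toLp fun l => ?_
  simp only [Matrix.mulVec, dotProduct, Matrix.transpose_apply]
  exact Finset.measurable_fun_sum _ fun i _ =>
    (hs.jacobian hr hu i l).mul ((hr.comp hs.1).euclideanSpace_apply i)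

theorem MeasurableState.direction (hr : Measurable r) (hs : MeasurableState s)
    (hu : Measurable u) : Measurable fun t => (s t).direction r (u t) := by
  have hJ := hs.jacobian hr hu
  have hg := hs.gradModel hr hu
  refine measurable_toLp fun l => ?_
  simp only [Pi.neg_apply, Matrix.mulVec, dotProduct]
  refine (Finset.measurable_fun_sum _ fun i _ => ?_).neg
  refine (measurable_matrix_inv (fun a l => ?_) _ _).mul (hg.euclideanSpace_apply i)
  simp only [Matrix.add_apply, Matrix.mul_apply, Matrix.transpose_apply, Matrix.smul_apply,
    smul_eq_mul]
  exact (Finset.measurable_fun_sum _ fun k _ => (hJ k a).mul (hJ k l)).add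
    ((hs.2.1.mul hg.norm).mul_const _)

theorem MeasurableState.ratio (hr : Measurable r) (hs : MeasurableState s)
    (hu : Measurable u) : Measurable fun t => (s t).ratio r (u t) := by
  have hJ := hs.jacobian hr hu
  have hd := hs.direction hr hu
  have h1 : Measurable fun t => r (s t).x := hr.comp hs.1
  have h2 : Measurable fun t => r ((s t).x + (s t).direction r (u t)) := hr.comp (hs.1.add hd)
  have h3 : Measurable fun t => (WithLp.toLp 2 (((s t).jacobian r (u t)).mulVec
      ((s t).direction r (u t)).ofLp) : EuclideanSpace ℝ (Fin m)) := by
    refine measurable_toLp fun i => ?_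
    simp only [Matrix.mulVec, dotProduct]
    exact Finset.measurable_fun_sum _ fun l _ => (hJ i l).mul (hd.euclideanSpace_apply l)
  exact ((h1.norm.pow_const 2).sub (h2.norm.pow_const 2)).div
    ((h1.norm.pow_const 2).sub ((h1.add h3).norm.pow_const 2))

theorem MeasurableState.next (c : LMParams) (hr : Measurable r) (hs : MeasurableState s)
    (hu : Measurable u) : MeasurableState fun t => (s t).next c r (u t) := by
  have hd := hs.direction hr hu
  have hρ := hs.ratio hr hu
  have hg := (hs.gradModel hr hu).norm
  have hθ := hs.2.1
  refine ⟨Measurable.ite (measurableSet_le measurable_const hρ) (hs.1.add hd) hs.1, ?_, hd⟩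
  exact Measurable.ite (measurableSet_lt hρ measurable_const) (hθ.const_mul _)
    (Measurable.ite (measurableSet_lt hg (hθ.const_div _)) (hθ.const_mul _)
      (Measurable.ite (measurableSet_lt hg (hθ.const_div _)) hθ
        ((hθ.const_mul _).max measurable_const)))

theorem measurableState_lmState (c : LMParams) (hr : Measurable r)
    (x₀ dInit : EuclideanSpace ℝ (Fin n)) {u : T → ℕ → Fin b → EuclideanSpace ℝ (Fin n)}
    (hu : ∀ k, Measurable fun t => u t k) (k : ℕ) :
    MeasurableState fun t => lmState c r x₀ dInit (u t) k := by
  induction k with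
  | zero => exact ⟨measurable_const, measurable_const, measurable_const⟩
  | succ k ih => exact ih.next c hr (hu k)

end Measurability

/-! ### Conditioning on the past frames, and the main theorem. -/

/-- The conditional probability, given `X`, of an event described by `X` and an independent `Y`
is bounded below by any lower bound for the probabilities of its sections. -/
theorem ae_le_condExp_of_indepFun {Ω β S : Type*} [MeasurableSpace Ω] [mβ : MeasurableSpace β]
    [MeasurableSpace S] [StandardBorelSpace S] [Nonempty S] {P : Measure Ω}
    [IsProbabilityMeasure P] {X : Ω → β} {Y : Ω → S} (hX : Measurable X) (hY : Measurable Y)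
    (hXY : IndepFun X Y P) {A : Set (β × S)} (hA : MeasurableSet A) {R : Set β} {α : ℝ}
    (h : ∀ x ∈ R, α ≤ (P.map Y).real {y | (x, y) ∈ A}) :
    ∀ᵐ ω ∂P, X ω ∈ R → α ≤ (P⟦{ω | (X ω, Y ω) ∈ A} | mβ.comap X⟧) ω := by
  have : IsProbabilityMeasure (P.map Y) := Measure.isProbabilityMeasure_map hY.aemeasurable
  -- Independence makes the joint law a product, so the conditional law of `Y` given `X` is a
  -- constant kernel.
  have hκ : condDistrib Y X P =ᵐ[P.map X] Kernel.const β (P.map Y) := by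
    rw [condDistrib_ae_eq_iff_measure_eq_compProd X hY.aemeasurable, Measure.compProd_const]
    exact hXY.map_prod_eq_prod_map_map hX.aemeasurable hY.aemeasurable
  have hf : StronglyMeasurable (A.indicator fun _ => (1 : ℝ)) :=
    stronglyMeasurable_const.indicator hA
  have hint : Integrable (fun ω => A.indicator (fun _ => (1 : ℝ)) (X ω, Y ω)) P :=
    (integrable_const (1 : ℝ)).indicator ((hX.prodMk hY) hA)
  filter_upwards [condExp_prod_ae_eq_integral_condDistrib hX hY.aemeasurable hf hint,
    ae_of_ae_map hX.aemeasurable hκ] with ω h1 h2 hω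
  refine (h _ hω).trans_eq (Eq.trans ?_ h1.symm)
  rw [h2, Kernel.const_apply]
  exact (integral_indicator_one (measurable_prodMk_left hA)).symm

/-- Presents the past as generated by a single random vector, as conditioning through `condDistrib`
requires. -/
theorem pastSigma_eq_comap {Ω S : Type*} [MeasurableSpace S] (U : ℕ → Ω → S) (k : ℕ) :
    pastSigma U k = MeasurableSpace.comap (fun ω (j : Fin k) => U j ω) inferInstance := by
  simp only [pastSigma, MeasurableSpace.pi, MeasurableSpace.comap_iSup,
    MeasurableSpace.comap_comp]
  rfl

theorem indepFun_past {Ω S : Type*} [MeasurableSpace Ω] [MeasurableSpace S] {P : Measure Ω}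
    {U : ℕ → Ω → S} (hU : ∀ k, Measurable (U k)) (h : iIndepFun U P) (k : ℕ) :
    IndepFun (fun ω (j : Fin k) => U j ω) (U k) P := by
  have h1 := h.indepFun_finset (Finset.range k) {k} (by simp) hU
  exact h1.comp
    (φ := fun (v : Finset.range k → S) (j : Fin k) => v ⟨j, Finset.mem_range.2 j.2⟩)
    (ψ := fun (v : ({k} : Finset ℕ) → S) => v ⟨k, Finset.mem_singleton_self k⟩)
    (by fun_prop) (by fun_prop)

theorem continuous_gradient_lsObjective {n m : ℕ}
    {r : EuclideanSpace ℝ (Fin n) → EuclideanSpace ℝ (Fin m)} (hr : ContDiff ℝ 1 r) :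
    Continuous (gradient (lsObjective r)) := by
  have h : ContDiff ℝ 1 (lsObjective r) :=
    contDiff_const.mul (ContDiff.sum fun i _ => (contDiff_euclidean.1 hr i).pow 2)
  exact (InnerProductSpace.toDual ℝ _).symm.continuous.comp (h.continuous_fderiv one_ne_zero)

theorem sqrt_div_sub_one_div_le {n b t δ : ℝ} (hb : 0 < b) (ht : 0 ≤ t) (hδ : 0 < δ)
    (h : n / (t ^ 2 * δ + 1) ≤ b) : Real.sqrt ((n / b - 1) / δ) ≤ t := by
  rw [Real.sqrt_le_left ht, div_le_iff₀ hδ, sub_le_iff_le_add, div_le_iff₀ hb, mul_comm]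
  exact (div_le_iff₀ (by positivity)).1 h

theorem lemma3p3
    {Ω : Type*} [MeasurableSpace Ω] (P : Measure Ω) [IsProbabilityMeasure P]
    (n m b : ℕ) (hb : 1 ≤ b) (hbn : b ≤ n)
    (r : EuclideanSpace ℝ (Fin n) → EuclideanSpace ℝ (Fin m)) (hr : ContDiff ℝ 1 r)
    -- the Jacobian is Lipschitz continuous, and `κ i` are Lipschitz constants of the `∇ rᵢ`
    (κlj : ℝ) (hκlj : 0 < κlj)
    (hJ : ∀ x y, ‖fderiv ℝ r x - fderiv ℝ r y‖ ≤ κlj * ‖x - y‖)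
    (κ : Fin m → ℝ) (hκ : ∀ i, 0 < κ i)
    (hgrad : ∀ i x y, ‖gradient (fun z => r z i) x - gradient (fun z => r z i) y‖
      ≤ κ i * ‖x - y‖)
    -- the input of the algorithm
    (c : LMParams) (hc : c.Valid)
    (x₀ : EuclideanSpace ℝ (Fin n)) (hx₀ : ‖r x₀‖ ≠ 0)
    (dInit : EuclideanSpace ℝ (Fin n)) (hdInit : dInit ≠ 0)
    -- the frames sampled in the successive iterations
    (U : ℕ → Ω → Fin b → EuclideanSpace ℝ (Fin n)) (hU : ∀ k, Measurable (U k))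
    (hindep : iIndepFun U P) (hlaw : ∀ k, P.map (U k) = stiefelUniform n b hbn)
    (η α : ℝ) (hη : 0 < η ∧ η < 1) (hα : 0 < α ∧ α < 1)
    (hbig : max ((n : ℝ) / (η ^ 2 * (1 - c.p₀) ^ 2 * (1 - α) / (2 + η * (1 - c.p₀)) ^ 2 + 1))
      ((n : ℝ) / 2) ≤ (b : ℝ)) :
    Real.sqrt (((n : ℝ) / b - 1) / (1 - α)) ≤ η * (1 - c.p₀) / (2 + η * (1 - c.p₀)) ∧
    IsProbFirstOrderAccurate P (pastSigma U)
      (fun k => {ω | lmReached c r x₀ dInit (fun j => U j ω) k})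
      (lsObjective r)
      (fun k ω => lmGradModel c r x₀ dInit (fun j => U j ω) k)
      (fun k ω => (lmState c r x₀ dInit (fun j => U j ω) k).x)
      (fun k ω => (lmState c r x₀ dInit (fun j => U j ω) k).dPrev)
      α
      (Real.sqrt (((n : ℝ) / b - 1) / (1 - α)))
      (Real.sqrt m * (⨆ i, κ i) * ((n : ℝ) / (2 * Real.sqrt (1 - α)) + 1) * ‖r x₀‖) := by
  have hδ : 0 < 1 - α := sub_pos.2 hα.2
  constructor
  · have hp : 0 < η * (1 - c.p₀) := mul_pos hη.1 (sub_pos.2 hc.2.2.2.2.2.1)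
    refine sqrt_div_sub_one_div_le (by positivity) (by positivity) hδ ?_
    -- Brings `t ^ 2 * (1 - α)`, with `t` the claimed bound on `ξ₁`, into the form of `hbig`.
    rw [div_pow, mul_pow, div_mul_eq_mul_div]
    exact (le_max_left _ _).trans hbig
  intro k
  set ξ₁ := Real.sqrt (((n : ℝ) / b - 1) / (1 - α))
  set K := ⨆ i, κ i
  have hK : 0 ≤ K := Real.iSup_nonneg fun i => (hκ i).le
  set ξ₂ := Real.sqrt m * K * ((n : ℝ) / (2 * Real.sqrt (1 - α)) + 1) * ‖r x₀‖ with hξ₂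
  have hgradK (i : Fin m) (x y : EuclideanSpace ℝ (Fin n)) :
      ‖gradient (fun z => r z i) y - gradient (fun z => r z i) x‖ ≤ K * ‖y - x‖ :=
    (hgrad i y x).trans
      (mul_le_mul_of_nonneg_right (le_ciSup (Finite.bddAbove_range κ) i) (norm_nonneg _))
  let S := Fin b → EuclideanSpace ℝ (Fin n)
  -- Pads the first `k` frames to a full sequence; the value `0` is immaterial, since the state
  -- before iteration `k` ignores later frames.
  let e : (Fin k → S) → ℕ → S := fun v j => if h : j < k then v ⟨j, h⟩ else 0
  have he (j : ℕ) : Measurable fun v => e v j := by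
    by_cases h : j < k
    · simp only [e, dif_pos h]
      exact measurable_pi_apply _
    · simp only [e, dif_neg h]
      exact measurable_const
  have hpast (ω : Ω) : ∀ j < k, U j ω = e (fun i => U i ω) j := fun j hj => by
    simp only [e, dif_pos hj]
  let s : (Fin k → S) → LMState n := fun v => lmState c r x₀ dInit (e v) k
  have hs_eq (ω : Ω) : s (fun j => U j ω) = lmState c r x₀ dInit (fun j => U j ω) k :=
    (lmState_congr (hpast ω)).symm
  let R : Set (Fin k → S) := {v | lmReached c r x₀ dInit (e v) k}
  let A : Set ((Fin k → S) × S) := {p | ‖(s p.1).gradModel r p.2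
    - gradient (lsObjective r) (s p.1).x‖
      ≤ ξ₁ * ‖gradient (lsObjective r) (s p.1).x‖ + ξ₂ * ‖(s p.1).dPrev‖}
  have hA_mem (v : Fin k → S) (y : S) : (v, y) ∈ A ↔ ‖(s v).gradModel r y
      - gradient (lsObjective r) (s v).x‖
        ≤ ξ₁ * ‖gradient (lsObjective r) (s v).x‖ + ξ₂ * ‖(s v).dPrev‖ := Iff.rfl
  have hs : MeasurableState fun p : (Fin k → S) × S => s p.1 :=
    measurableState_lmState c hr.continuous.measurable x₀ dInit
      (fun j => (he j).comp measurable_fst) k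
  have hA : MeasurableSet A := by
    have hg : Measurable fun p : (Fin k → S) × S => gradient (lsObjective r) (s p.1).x :=
      (continuous_gradient_lsObjective hr).measurable.comp hs.1
    exact measurableSet_le
      ((hs.gradModel hr.continuous.measurable measurable_snd).sub hg).norm
      ((hg.norm.const_mul _).add (hs.2.2.norm.const_mul _))
  have hR : ∀ v ∈ R, α ≤ (P.map (U k)).real {y | (v, y) ∈ A} := by
    intro v hv
    rw [hlaw]
    refine (le_stiefelUniform_norm_modelGradient_sub_le hb hbn (hr.differentiable one_ne_zero) hK
      (fun i y => hgradK i (s v).x y)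
      (norm_pos_iff.2 (lmState_dPrev_ne_zero hc hdInit hv)) hα.2).trans ?_
    refine measureReal_mono fun u hu =>
      (hA_mem v u).2 (le_trans (b := _ + _) hu (add_le_add_right ?_ _))
    -- The bias constant `n/2` is smaller than the one in `ξ₂`, which leaves slack.
    have h1 : (n : ℝ) / 2 ≤ n / (2 * Real.sqrt (1 - α)) + 1 := by
      refine le_add_of_le_of_nonneg ?_ zero_le_one
      have h2 : Real.sqrt (1 - α) ≤ 1 := Real.sqrt_le_one.2 (by linarith)
      have h3 : 0 < Real.sqrt (1 - α) := Real.sqrt_pos.2 hδ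
      gcongr
      linarith
    calc _ ≤ ((n : ℝ) / (2 * Real.sqrt (1 - α)) + 1)
          * (Real.sqrt m * K * ‖r x₀‖ * ‖(s v).dPrev‖) := by
          gcongr
          exact norm_residual_lmState_le hc hv
      _ = _ := by
          rw [hξ₂]
          ring
  have hmain := ae_le_condExp_of_indepFun (measurable_pi_lambda _ fun j : Fin k => hU j) (hU k)
    (indepFun_past hU hindep k) hA hR
  have hE : {ω | ((fun j : Fin k => U j ω), U k ω) ∈ A} = {ω |
      ‖lmGradModel c r x₀ dInit (fun j => U j ω) k
        - gradient (lsObjective r) (lmState c r x₀ dInit (fun j => U j ω) k).x‖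
      ≤ ξ₁ * ‖gradient (lsObjective r) (lmState c r x₀ dInit (fun j => U j ω) k).x‖
        + ξ₂ * ‖(lmState c r x₀ dInit (fun j => U j ω) k).dPrev‖} := by
    ext ω
    refine (hA_mem _ _).trans ?_
    simp only [hs_eq]
    rfl
  rw [hE, ← pastSigma_eq_comap] at hmain
  filter_upwards [hmain] with ω hω hreached
  exact hω ((lmReached_congr (hpast ω)).1 hreached)
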